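/- Let $(X_i)_{i\ge 1}$ be independent, identically distributed $\mathbb Z$-valued random variables on a probability space $(\Omega,\mathcal A,\mathbb P)$, and let $S_0=0$, $S_n=\sum_{i=1}^n X_i$. Assume that the random walk $(S_n)_{n\ge0}$ is transient, i.e. $\mathbb P(\exists n\ge 1:\ S_n=0)<1$; its Green function $G(0,x)=\sum_{k=0}^{\infty}\mathbb P(S_k=x)$, $x\in\mathbb Z$, is then finite. Let $(E,\mathcal E,\mu)$ be a probability space, $T:E\to E$ a bijective bimeasurable transformation preserving $\mu$, and $f\in\mathbb L^2(\mu)$ a real-valued function with $\mathbb E_\mu(f)=0$. For $n\ge 0$, $z\in\mathbb Z$ and $\omega\in\Omega$ put $$\sigma_n^2(f)=\sigma_n^2(f)(\omega)=\mathbb E_\mu\Big(\Big|\sum_{k=0}^{n} f\circ T^{S_k(\omega)}\Big|^2\Big),\qquad \alpha(n,z)=\alpha(n,z)(\omega)=\sum_{i,j=0}^{n}\mathbf 1_{\{S_i(\omega)-S_j(\omega)=z\}} .$$ Suppose that $\sum_{x\in\mathbb Z}G(0,x)\,\mathbb E_\mu(f\cdot f\circ T^x)$ converges absolutely, and put $$\sigma^2(f)=2\sum_{x\in\mathbb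 Z}G(0,x)\,\mathbb E_\mu(f\cdot f\circ T^x)-\mathbb E_\mu(f^2).$$ Then $\sigma_n^2(f)(\omega)=\sum_{z\in\mathbb Z}\alpha(n,z)(\omega)\,\mathbb E_\mu(f\cdot f\circ T^z)$ for all $n\ge0$ and $\omega\in\Omega$, and, $\mathbb P$-almost surely, $$\frac{\sigma_n^2(f)}{n}\longrightarrow\sigma^2(f)\qquad(n\to\infty).$$ -/

import Mathlib

open Filter Topology MeasureTheory ProbabilityTheory

noncomputable section

namespace SampledWalk

section Walk

variable {Ω : Type*}

/-- The random walk `S_n = X_1 + ⋯ + X_n`, `S_0 = 0`. The steps are indexed from zero: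
`X i` is the `(i+1)`-st step of the walk. -/
def walk (X : ℕ → Ω → ℤ) (n : ℕ) (ω : Ω) : ℤ :=
  ∑ i ∈ Finset.range n, X i ω

/-- The walk is transient: with positive probability it never returns to its starting point. -/
def IsTransient [MeasurableSpace Ω] (P : Measure Ω) (X : ℕ → Ω → ℤ) : Prop :=
  P {ω | ∃ n : ℕ, 1 ≤ n ∧ walk X n ω = 0} < 1

/-- The Green function `G(0,x) = ∑_{k ≥ 0} P(S_k = x)`
(a convergent series for a transient walk). -/
def green [MeasurableSpace Ω] (P : Measure Ω) (X : ℕ → Ω → ℤ) (x : ℤ) : ℝ :=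
  ∑' k : ℕ, P.real {ω | walk X k ω = x}

/-- The self-intersection local time `α(n,x) = ∑_{i,j=0}^n 1_{S_i - S_j = x}`. -/
def selfIntersection (X : ℕ → Ω → ℤ) (n : ℕ) (x : ℤ) (ω : Ω) : ℝ :=
  ∑ i ∈ Finset.range (n + 1), ∑ j ∈ Finset.range (n + 1),
    if walk X i ω - walk X j ω = x then 1 else 0

end Walk

section Dynamics

variable {E : Type*} [MeasurableSpace E]

/-- The iterate `T^x`, `x ∈ ℤ`, of an invertible bimeasurable map; for `x < 0` it is the
iterate of the inverse. -/
def iter (T : E ≃ᵐ E) (x : ℤ) (e : E) : E :=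
  ((T.toEquiv : Equiv.Perm E) ^ x) e

/-- The correlation `E_μ(f · f ∘ T^x)`. -/
def corr (μ : Measure E) (T : E ≃ᵐ E) (f : E → ℝ) (x : ℤ) : ℝ :=
  ∫ e, f e * f (iter T x e) ∂μ

end Dynamics

variable {Ω E : Type*} [MeasurableSpace E]

/-- The quenched variance `σ_n²(f)(ω) = E_μ |∑_{k=0}^n f ∘ T^{S_k(ω)}|²`. -/
def quenchedVar (X : ℕ → Ω → ℤ) (μ : Measure E) (T : E ≃ᵐ E) (f : E → ℝ)
    (n : ℕ) (ω : Ω) : ℝ :=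
  ∫ e, |∑ k ∈ Finset.range (n + 1), f (iter T (walk X k ω) e)| ^ 2 ∂μ

/-- The limit variance `σ²(f) = 2 ∑_{x ∈ ℤ} G(0,x) E_μ(f · f ∘ T^x) - E_μ(f²)`. -/
def limitVar [MeasurableSpace Ω] (P : Measure Ω) (X : ℕ → Ω → ℤ) (μ : Measure E)
    (T : E ≃ᵐ E) (f : E → ℝ) : ℝ :=
  2 * (∑' x : ℤ, green P X x * corr μ T f x) - ∫ e, f e ^ 2 ∂μ

end SampledWalk

end

open scoped NNReal ENNReal

/-! Write `c = corr μ T f`. Expanding the square and using invariance of `μ`, the quenched variance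
is the sum of `c (S_i - S_j)` over `i, j ≤ n`. Since `c` is even, this is `(n+1) c 0` plus twice the
sum over `i < j`. Grouped by `i`, the latter is a truncated Birkhoff sum, for the shift on step
sequences, of `F = ∑_{l ≥ 1} c (S_l)`, whose mean is `∑ G(0,x) c x - c 0`. The shift is ergodic
(`ergodic_shift`), so Birkhoff's theorem (`ae_tendsto_birkhoffSum_div`) gives the limit once the
truncation is controlled. For `c ≥ 0` this is a sandwich (`ae_tendsto_pairSum_nnreal`); the general
case splits `c` into positive and negative parts. Transience enters only to make the Green function
finite. -/

namespace SampledWalk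

/-! ### Maximal inequality and Birkhoff's theorem -/

section Birkhoff

variable {α : Type*} {T : α → α} {f : α → ℝ}

/-- The maximal function `max_{0 ≤ k ≤ n} ∑_{i < k} f ∘ T^i`, defined by recursion on `n`. -/
def maxSum (T : α → α) (f : α → ℝ) : ℕ → α → ℝ
  | 0, _ => 0
  | n + 1, x => max 0 (f x + maxSum T f n (T x))

lemma maxSum_nonneg (n : ℕ) (x : α) : 0 ≤ maxSum T f n x := by
  cases n with
  | zero => exact le_rfl
  | succ n => exact le_max_left _ _

lemma maxSum_le_succ (n : ℕ) (x : α) : maxSum T f n x ≤ maxSum T f (n + 1) x := by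
  induction n generalizing x with
  | zero => exact maxSum_nonneg 1 x
  | succ n ih => exact max_le_max le_rfl (add_le_add le_rfl (ih (T x)))

lemma monotone_maxSum (x : α) : Monotone fun n => maxSum T f n x :=
  monotone_nat_of_le_succ fun n => maxSum_le_succ n x

lemma birkhoffSum_le_maxSum (n : ℕ) (x : α) : birkhoffSum T f n x ≤ maxSum T f n x := by
  induction n generalizing x with
  | zero => simp [maxSum]
  | succ n ih =>
    rw [birkhoffSum_succ']
    exact (add_le_add le_rfl (ih (T x))).trans (le_max_right _ _)

variable [MeasurableSpace α] {μ : Measure α}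

lemma measurable_maxSum (hT : Measurable T) (hf : Measurable f) (n : ℕ) :
    Measurable (maxSum T f n) := by
  induction n with
  | zero => exact measurable_const
  | succ n ih => exact measurable_const.max (hf.add (ih.comp hT))

lemma integrable_maxSum [IsFiniteMeasure μ] (hT : MeasurePreserving T μ μ) (hf : Integrable f μ)
    (n : ℕ) : Integrable (maxSum T f n) μ := by
  induction n with
  | zero => exact integrable_zero _ _ _
  | succ n ih => exact (integrable_zero _ _ _).sup (hf.add (hT.integrable_comp_of_integrable ih))

/-- The maximal ergodic inequality. -/
lemma setIntegral_maxSum_pos_nonneg [IsFiniteMeasure μ] (hT : MeasurePreserving T μ μ)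
    (hfm : Measurable f) (hf : Integrable f μ) (n : ℕ) :
    0 ≤ ∫ x in {x | 0 < maxSum T f n x}, f x ∂μ := by
  set M := maxSum T f n with hM
  have hMi : Integrable M μ := integrable_maxSum hT hf n
  have hMTi : Integrable (fun x => M (T x)) μ := hT.integrable_comp_of_integrable hMi
  have hA : MeasurableSet {x | 0 < M x} :=
    measurableSet_lt measurable_const (measurable_maxSum hT.measurable hfm n)
  -- Where `M` is positive, the recursion attains its maximum at `f x + maxSum T f n (T x)`. Off
  -- this set `M` vanishes, and `M ∘ T ≥ 0`, so integrating leaves at least `∫ M - ∫ M ∘ T = 0`.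
  have hle : ∀ x ∈ {x | 0 < M x}, M x - M (T x) ≤ f x := by
    intro x hx
    cases n with
    | zero => exact (lt_irrefl (0 : ℝ) hx).elim
    | succ n =>
      have h1 : 0 < max 0 (f x + maxSum T f n (T x)) := hx
      have h2 : M x = f x + maxSum T f n (T x) :=
        max_eq_right (not_lt.1 fun h => by rw [max_eq_left h.le] at h1; exact lt_irrefl _ h1)
      have h3 := maxSum_le_succ (T := T) (f := f) n (T x)
      rw [hM] at *
      linarith
  have h1 : ∫ x in {x | 0 < M x}, (M x - M (T x)) ∂μ ≤ ∫ x in {x | 0 < M x}, f x ∂μ :=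
    setIntegral_mono_on (hMi.sub hMTi).integrableOn hf.integrableOn hA hle
  have h2 : ∫ x in {x | 0 < M x}, M x ∂μ = ∫ x, M x ∂μ := by
    refine setIntegral_eq_integral_of_forall_compl_eq_zero fun x hx => ?_
    exact le_antisymm (not_lt.1 hx) (maxSum_nonneg n x)
  have h3 : ∫ x in {x | 0 < M x}, M (T x) ∂μ ≤ ∫ x, M (T x) ∂μ :=
    setIntegral_le_integral hMTi (Eventually.of_forall fun x => maxSum_nonneg n (T x))
  have h4 : ∫ x, M (T x) ∂μ = ∫ x, M x ∂μ := by
    rw [← integral_map hT.measurable.aemeasurable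
      (by rw [hT.map_eq]; exact hMi.aestronglyMeasurable), hT.map_eq]
  rw [integral_sub hMi.integrableOn hMTi.integrableOn] at h1
  linarith

/-- The set `B` of bounded orbits is invariant, hence null or conull. If it were null, `maxSum`
would eventually be positive almost everywhere, and the maximal inequality would give `0 ≤ ∫ f` in
the limit. -/
lemma ae_bddAbove_birkhoffSum [IsProbabilityMeasure μ] (hT : Ergodic T μ)
    (hfm : Measurable f) (hf : Integrable f μ) (hneg : ∫ x, f x ∂μ < 0) :
    ∀ᵐ x ∂μ, BddAbove (Set.range fun n => birkhoffSum T f n x) := by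
  set B : Set α := {x | ∃ K : ℕ, ∀ n, birkhoffSum T f n x ≤ K} with hB
  have hSm : ∀ n, Measurable (birkhoffSum T f n) := fun n =>
    Finset.measurable_sum _ fun i _ => hfm.comp (hT.measurable.iterate i)
  have hBm : MeasurableSet B := by
    have : B = ⋃ K : ℕ, ⋂ n, {x | birkhoffSum T f n x ≤ K} := by ext; simp [hB]
    rw [this]
    exact .iUnion fun K => .iInter fun n => measurableSet_le (hSm n) measurable_const
  have hBinv : T ⁻¹' B = B := by
    ext x
    constructor
    · rintro ⟨K, hK⟩
      obtain ⟨L, hL⟩ := exists_nat_ge (f x + K)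
      refine ⟨L, fun n => ?_⟩
      cases n with
      | zero => simp
      | succ n => rw [birkhoffSum_succ']; linarith [hK n]
    · rintro ⟨K, hK⟩
      obtain ⟨L, hL⟩ := exists_nat_ge (K - f x)
      refine ⟨L, fun n => ?_⟩
      have := hK (n + 1)
      rw [birkhoffSum_succ'] at this
      linarith
  have key : μ B ≠ 0 := by
    intro h0
    have hpos : ∀ᵐ x ∂μ, ∃ n, 0 < maxSum T f n x := by
      filter_upwards [measure_eq_zero_iff_ae_notMem.1 h0] with x hx
      by_contra! hcon
      exact hx ⟨0, fun n => by simpa using (birkhoffSum_le_maxSum n x).trans (hcon n)⟩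
    have hlim : Tendsto (fun n => ∫ x in {x | 0 < maxSum T f n x}, f x ∂μ) atTop
        (𝓝 (∫ x, f x ∂μ)) := by
      have hmeas : ∀ n, MeasurableSet {x | 0 < maxSum T f n x} := fun n =>
        measurableSet_lt measurable_const (measurable_maxSum hT.measurable hfm n)
      simp_rw [← integral_indicator (hmeas _)]
      refine tendsto_integral_of_dominated_convergence (fun x => ‖f x‖)
        (fun n => (hfm.indicator (hmeas n)).aestronglyMeasurable) hf.norm
        (fun n => Eventually.of_forall fun x => norm_indicator_le_norm_self _ _) ?_
      filter_upwards [hpos] with x ⟨n, hn⟩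
      refine tendsto_const_nhds.congr' ?_
      filter_upwards [eventually_ge_atTop n] with m hm
      exact (Set.indicator_of_mem
        (show x ∈ {x | 0 < maxSum T f m x} from hn.trans_le (monotone_maxSum x hm)) f).symm
    have := ge_of_tendsto' hlim fun n =>
      setIntegral_maxSum_pos_nonneg hT.toMeasurePreserving hfm hf n
    linarith
  have hae := (hT.toPreErgodic.measure_self_or_compl_eq_zero hBm hBinv).resolve_left key
  filter_upwards [mem_ae_iff.2 hae] with x ⟨K, hK⟩
  exact ⟨K, by rintro _ ⟨n, rfl⟩; exact hK n⟩

/-- Subtracting `a + ε / 2` makes the mean negative, so the centred sums are bounded by some `K`;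
the remaining `ε / 2` absorbs `K / n`. -/
lemma ae_eventually_birkhoffSum_div_le [IsProbabilityMeasure μ] (hT : Ergodic T μ)
    (hfm : Measurable f) (hf : Integrable f μ) {ε : ℝ} (hε : 0 < ε) :
    ∀ᵐ x ∂μ, ∀ᶠ n : ℕ in atTop, birkhoffSum T f n x / n ≤ ∫ x, f x ∂μ + ε := by
  set a := ∫ x, f x ∂μ
  have hneg : ∫ x, (f x - (a + ε / 2)) ∂μ < 0 := by
    rw [integral_sub hf (integrable_const _)]
    simp only [integral_const, probReal_univ, smul_eq_mul, one_mul]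
    linarith
  filter_upwards [ae_bddAbove_birkhoffSum hT (hfm.sub_const _) (hf.sub (integrable_const _)) hneg]
    with x ⟨K, hK⟩
  obtain ⟨m, hm⟩ := exists_nat_gt (K / (ε / 2))
  filter_upwards [eventually_ge_atTop (max m 1)] with n hn
  have hn0 : (0 : ℝ) < n := by exact_mod_cast (le_max_right m 1).trans hn
  have hmn : (m : ℝ) ≤ n := by exact_mod_cast (le_max_left m 1).trans hn
  have h1 : birkhoffSum T (fun x => f x - (a + ε / 2)) n x ≤ K := hK ⟨n, rfl⟩
  have h2 : birkhoffSum T (fun x => f x - (a + ε / 2)) n x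
      = birkhoffSum T f n x - n * (a + ε / 2) := by
    simp only [birkhoffSum, Finset.sum_sub_distrib, Finset.sum_const, Finset.card_range,
      nsmul_eq_mul]
  rw [div_lt_iff₀ (by positivity)] at hm
  rw [div_le_iff₀ hn0]
  have := mul_le_mul_of_nonneg_right hmn (half_pos hε).le
  linarith

/-- Birkhoff's pointwise ergodic theorem for an ergodic transformation. -/
theorem ae_tendsto_birkhoffSum_div [IsProbabilityMeasure μ] (hT : Ergodic T μ)
    (hfm : Measurable f) (hf : Integrable f μ) :
    ∀ᵐ x ∂μ, Tendsto (fun n : ℕ => birkhoffSum T f n x / n) atTop (𝓝 (∫ x, f x ∂μ)) := by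
  have hup := ae_all_iff.2 fun k : ℕ =>
    ae_eventually_birkhoffSum_div_le hT hfm hf (Nat.one_div_pos_of_nat (α := ℝ) (n := k))
  have hlo := ae_all_iff.2 fun k : ℕ =>
    ae_eventually_birkhoffSum_div_le hT hfm.neg hf.neg (Nat.one_div_pos_of_nat (α := ℝ) (n := k))
  filter_upwards [hup, hlo] with x hx hx'
  rw [Metric.tendsto_atTop']
  intro ε hε
  obtain ⟨k, hk⟩ := exists_nat_one_div_lt hε
  obtain ⟨N, hN⟩ := eventually_atTop.1 ((hx k).and (hx' k))
  refine ⟨N, fun n hn => ?_⟩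
  obtain ⟨h1, h2⟩ := hN n hn.le
  have h3 : ∫ x, (-f) x ∂μ = -∫ x, f x ∂μ := integral_neg _
  rw [birkhoffSum_neg, neg_div, h3] at h2
  rw [Real.dist_eq, abs_lt]
  constructor <;> linarith

end Birkhoff

/-! ### Ergodicity of the Bernoulli shift -/

section Shift

/-- The shift on sequences. -/
def shift {S : Type*} (y : ℕ → S) : ℕ → S := fun i => y (i + 1)

lemma shift_iterate {S : Type*} (k : ℕ) (y : ℕ → S) : shift^[k] y = fun i => y (i + k) := by
  induction k generalizing y with
  | zero => rfl
  | succ k ih => rw [Function.iterate_succ_apply, ih]; ext i; exact congrArg y (by omega)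

variable {S : Type*} [mS : MeasurableSpace S]

lemma measurable_shift : Measurable (shift : (ℕ → S) → ℕ → S) :=
  measurable_pi_lambda _ fun i => measurable_pi_apply (i + 1)

/-- The `σ`-algebra generated by the `i`-th coordinate. -/
abbrev coordAlgebra (S : Type*) [mS : MeasurableSpace S] (i : ℕ) : MeasurableSpace (ℕ → S) :=
  mS.comap fun y => y i

lemma coordAlgebra_le (i : ℕ) : coordAlgebra S i ≤ MeasurableSpace.pi :=
  (measurable_pi_apply i).comap_le

lemma measurable_shift_iterate_iSup (k : ℕ) :
    Measurable[⨆ i ∈ Set.Ici k, coordAlgebra S i] (shift^[k] : (ℕ → S) → ℕ → S) := by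
  refine @measurable_pi_lambda _ _ _ (_) _ _ fun i => ?_
  simp only [shift_iterate]
  exact (comap_measurable fun y : ℕ → S => y (i + k)).mono
    (le_iSup₂_of_le (i + k) (Set.mem_Ici.2 (Nat.le_add_left k i)) le_rfl) le_rfl

variable (p : Measure S) [IsProbabilityMeasure p]

lemma iIndep_coordAlgebra : iIndep (coordAlgebra S) (Measure.infinitePi fun _ : ℕ => p) :=
  iIndepFun_infinitePi (P := fun _ : ℕ => p) (X := fun _ s => s) fun _ => measurable_id

lemma measurePreserving_shift :
    MeasurePreserving shift (Measure.infinitePi fun _ : ℕ => p)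
      (Measure.infinitePi fun _ : ℕ => p) :=
  ⟨measurable_shift, Measure.map_infinitePi_infinitePi_of_inj (P := fun _ : ℕ => p)
    (add_left_injective 1)⟩

lemma indep_past_future (k : ℕ) :
    Indep (⨆ i ∈ Set.Iio k, coordAlgebra S i) (⨆ i ∈ Set.Ici k, coordAlgebra S i)
      (Measure.infinitePi fun _ : ℕ => p) :=
  indep_iSup_of_disjoint coordAlgebra_le (iIndep_coordAlgebra p)
    (Set.disjoint_left.2 fun _ h h' => not_le.2 (Set.mem_Iio.1 h) (Set.mem_Ici.1 h'))

/-- An invariant set equals its preimage under `shift^[k]`, so it depends only on coordinates `≥ k`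
for every `k`. It is a tail event, and Kolmogorov's zero-one law applies. -/
lemma ergodic_shift : Ergodic shift (Measure.infinitePi fun _ : ℕ => p) where
  toMeasurePreserving := measurePreserving_shift p
  toPreErgodic := by
    refine ⟨fun s hs hinv => ?_⟩
    have hit : ∀ k, shift^[k] ⁻¹' s = s := fun k => by
      rw [Set.preimage_iterate_eq]
      exact Function.iterate_fixed hinv k
    have htail : MeasurableSet[limsup (coordAlgebra S) atTop] s := by
      rw [limsup_eq_iInf_iSup_of_nat]
      refine MeasurableSpace.measurableSet_iInf.2 fun k => ?_
      have := measurable_shift_iterate_iSup (S := S) k hs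
      rwa [hit k] at this
    rw [Filter.eventuallyConst_set']
    rcases measure_zero_or_one_of_measurableSet_limsup_atTop coordAlgebra_le
      (iIndep_coordAlgebra p) htail with h | h
    · exact Or.inl (ae_eq_empty.2 h)
    · exact Or.inr (ae_eq_univ.2 ((prob_compl_eq_zero_iff hs).2 h))

end Shift

/-! ### Finiteness of the Green function -/

section Position

/-- The position after `k` steps of the walk whose steps are `y 0, y 1, …`. -/
def pos (k : ℕ) (y : ℕ → ℤ) : ℤ := ∑ i ∈ Finset.range k, y i

lemma pos_add (k l : ℕ) (y : ℕ → ℤ) : pos (k + l) y = pos k y + pos l (shift^[k] y) := by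
  simp [pos, Finset.sum_range_add, shift_iterate, add_comm]

lemma measurable_pos_iSup (k : ℕ) : Measurable[⨆ i ∈ Set.Iio k, coordAlgebra ℤ i] (pos k) := by
  refine Finset.measurable_sum _ fun i hi => ?_
  exact (comap_measurable fun y : ℕ → ℤ => y i).mono
    (le_iSup₂_of_le i (Finset.mem_range.1 hi) le_rfl) le_rfl

lemma measurable_pos (k : ℕ) : Measurable (pos k) :=
  Finset.measurable_sum _ fun i _ => measurable_pi_apply i

lemma measurableSet_pos_eq (k : ℕ) (x : ℤ) : MeasurableSet {y | pos k y = x} :=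
  measurable_pos k (measurableSet_singleton x)

lemma measurableSet_return : MeasurableSet {y : ℕ → ℤ | ∃ n : ℕ, 1 ≤ n ∧ pos n y = 0} := by
  have : {y : ℕ → ℤ | ∃ n : ℕ, 1 ≤ n ∧ pos n y = 0}
      = ⋃ n : ℕ, ⋃ _ : 1 ≤ n, {y | pos n y = 0} := by ext; simp
  rw [this]
  exact .iUnion fun n => .iUnion fun _ => measurableSet_pos_eq n 0

variable (p : Measure ℤ) [IsProbabilityMeasure p]

/-- The law of the sequence of steps of a random walk with step distribution `p`. -/
noncomputable abbrev stepLaw (p : Measure ℤ) : Measure (ℕ → ℤ) := Measure.infinitePi fun _ : ℕ => p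

/-- Decomposition according to the last visit to `x`. -/
lemma tsum_pos_mul_escape_le (x : ℤ) :
    (∑' k, stepLaw p {y | pos k y = x}) * stepLaw p {y | ∃ n : ℕ, 1 ≤ n ∧ pos n y = 0}ᶜ ≤ 1 := by
  set R : Set (ℕ → ℤ) := {y | ∃ n : ℕ, 1 ≤ n ∧ pos n y = 0}
  have hRm : MeasurableSet R := measurableSet_return
  -- By independence and stationarity, each product is the probability that time `k` is the last
  -- visit to `x`; these events are disjoint.
  have hind : ∀ k, stepLaw p {y | pos k y = x} * stepLaw p Rᶜ
      = stepLaw p ({y | pos k y = x} ∩ shift^[k] ⁻¹' Rᶜ) := fun k => by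
    have h := (Indep_iff _ _ _).1 (indep_past_future p k) {y | pos k y = x} (shift^[k] ⁻¹' Rᶜ)
      (measurable_pos_iSup k (measurableSet_singleton x))
      (measurable_shift_iterate_iSup k hRm.compl)
    rw [h, ((measurePreserving_shift p).iterate k).measure_preimage hRm.compl.nullMeasurableSet]
  rw [← ENNReal.tsum_mul_right]
  simp_rw [hind]
  rw [← measure_iUnion]
  · exact prob_le_one
  · have aux : ∀ i j, i < j → Disjoint ({y | pos i y = x} ∩ shift^[i] ⁻¹' Rᶜ)
        ({y | pos j y = x} ∩ shift^[j] ⁻¹' Rᶜ) := by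
      intro i j hij
      rw [Set.disjoint_left]
      rintro y ⟨h1, h2⟩ ⟨h3, -⟩
      obtain ⟨l, rfl⟩ := Nat.exists_eq_add_of_lt hij
      refine h2 ⟨l + 1, Nat.le_add_left 1 l, ?_⟩
      have h4 := pos_add i (l + 1) y
      rw [Set.mem_ofPred_eq] at h1 h3
      rw [← add_assoc] at h4
      omega
    intro i j hij
    rcases lt_or_gt_of_ne hij with h | h
    · exact aux i j h
    · exact (aux j i h).symm
  · exact fun k => (measurable_pos k (measurableSet_singleton x)).inter
      ((measurable_shift.iterate k) hRm.compl)

lemma tsum_pos_ne_top (htr : stepLaw p {y | ∃ n : ℕ, 1 ≤ n ∧ pos n y = 0} < 1) (x : ℤ) :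
    ∑' k, stepLaw p {y | pos k y = x} ≠ ⊤ := by
  intro h
  have h1 := tsum_pos_mul_escape_le p x
  have h2 : stepLaw p {y | ∃ n : ℕ, 1 ≤ n ∧ pos n y = 0}ᶜ ≠ 0 := by
    intro h0
    have := measure_union_le (μ := stepLaw p) {y | ∃ n : ℕ, 1 ≤ n ∧ pos n y = 0}
      {y | ∃ n : ℕ, 1 ≤ n ∧ pos n y = 0}ᶜ
    rw [Set.union_compl_self, measure_univ, h0, add_zero] at this
    exact absurd htr (not_lt.2 this)
  rw [h, ENNReal.top_mul h2] at h1
  exact absurd h1 (by simp)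

end Position

/-! ### Pair sums as truncated Birkhoff sums -/

section PairSums

/-- The sum of `g (S_j - S_i)` over the pairs `i < j < n`. -/
def pairSum (g : ℤ → ℝ) (n : ℕ) (y : ℕ → ℤ) : ℝ :=
  ∑ j ∈ Finset.range n, ∑ i ∈ Finset.range j, g (pos j y - pos i y)

lemma pairSum_eq_sum_shift (g : ℤ → ℝ) (n : ℕ) (y : ℕ → ℤ) :
    pairSum g n y = ∑ i ∈ Finset.range n, ∑ l ∈ Finset.range (n - (i + 1)),
      g (pos (l + 1) (shift^[i] y)) := by
  have h : pairSum g n y = ∑ i ∈ Finset.range n, ∑ j ∈ Finset.Ico (i + 1) n,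
      g (pos j y - pos i y) := by
    refine Finset.sum_comm' fun j i => ?_
    simp only [Finset.mem_range, Finset.mem_Ico]
    omega
  rw [h]
  refine Finset.sum_congr rfl fun i _ => ?_
  rw [Finset.sum_Ico_eq_sum_range]
  refine Finset.sum_congr rfl fun l _ => ?_
  rw [show i + 1 + l = i + (l + 1) by omega, pos_add, add_sub_cancel_left]

lemma sum_sum_eq_pairSum {g : ℤ → ℝ} (hg : ∀ x, g (-x) = g x) (n : ℕ) (y : ℕ → ℤ) :
    ∑ i ∈ Finset.range n, ∑ j ∈ Finset.range n, g (pos i y - pos j y)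
      = n * g 0 + 2 * pairSum g n y := by
  induction n with
  | zero => simp [pairSum]
  | succ n ih =>
    have h : ∀ i, g (pos i y - pos n y) = g (pos n y - pos i y) := fun i => by
      rw [← hg, neg_sub]
    have hs : pairSum g (n + 1) y
        = pairSum g n y + ∑ i ∈ Finset.range n, g (pos n y - pos i y) :=
      Finset.sum_range_succ _ n
    rw [hs, Finset.sum_range_succ (n := n)]
    simp_rw [Finset.sum_range_succ (n := n), Finset.sum_add_distrib]
    rw [ih]
    simp only [h, sub_self]
    push_cast
    ring

variable (p : Measure ℤ) (c : ℤ → ℝ≥0)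

lemma lintegral_comp_pos (k : ℕ) :
    ∫⁻ y, (c (pos k y) : ℝ≥0∞) ∂stepLaw p = ∑' x, (c x : ℝ≥0∞) * stepLaw p {y | pos k y = x} := by
  rw [← lintegral_map (f := fun x => (c x : ℝ≥0∞)) (measurable_of_countable _) (measurable_pos k),
    lintegral_countable']
  refine tsum_congr fun x => ?_
  rw [Measure.map_apply (measurable_pos k) (measurableSet_singleton x)]
  rfl

/-- The expected sum of `c` along the walk is computed by the Green function. -/
lemma tsum_lintegral_comp_pos :
    ∑' k, ∫⁻ y, (c (pos k y) : ℝ≥0∞) ∂stepLaw p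
      = ∑' x, (c x : ℝ≥0∞) * ∑' k, stepLaw p {y | pos k y = x} := by
  simp_rw [lintegral_comp_pos, ← ENNReal.tsum_mul_left]
  exact ENNReal.tsum_comm

lemma measurable_comp_pos (k : ℕ) : Measurable fun y => (c (pos k y) : ℝ≥0∞) :=
  (measurable_of_countable fun x => (c x : ℝ≥0∞)).comp (measurable_pos k)

/-- Truncation only drops nonnegative terms, so the Birkhoff sums of `F` bound from above. Those of
the partial sums `K N` bound from below, and their means increase to `A`. -/
lemma ae_tendsto_pairSum_nnreal [IsProbabilityMeasure p]
    (hfin : ∑' l, ∫⁻ y, (c (pos (l + 1) y) : ℝ≥0∞) ∂stepLaw p ≠ ⊤) :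
    ∀ᵐ y ∂stepLaw p, Tendsto (fun n : ℕ => pairSum (fun x => c x) n y / n) atTop
      (𝓝 (∑' l, ∫⁻ y, (c (pos (l + 1) y) : ℝ≥0∞) ∂stepLaw p).toReal) := by
  set A := ∑' l, ∫⁻ y, (c (pos (l + 1) y) : ℝ≥0∞) ∂stepLaw p with hA
  set F : (ℕ → ℤ) → ℝ≥0∞ := fun y => ∑' l, (c (pos (l + 1) y) : ℝ≥0∞) with hF
  set K : ℕ → (ℕ → ℤ) → ℝ≥0∞ := fun N y => ∑ l ∈ Finset.range N, (c (pos (l + 1) y) : ℝ≥0∞)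
    with hK
  have hFm : Measurable F := .tsum fun l => measurable_comp_pos c (l + 1)
  have hKm : ∀ N, Measurable (K N) := fun N =>
    Finset.measurable_sum _ fun l _ => measurable_comp_pos c (l + 1)
  have hFA : ∫⁻ y, F y ∂stepLaw p = A :=
    lintegral_tsum fun l => (measurable_comp_pos c (l + 1)).aemeasurable
  have hKA : ∀ N, ∫⁻ y, K N y ∂stepLaw p
      = ∑ l ∈ Finset.range N, ∫⁻ y, (c (pos (l + 1) y) : ℝ≥0∞) ∂stepLaw p := fun N =>
    lintegral_finsetSum _ fun l _ => measurable_comp_pos c (l + 1)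
  have hKtop : ∀ N, ∫⁻ y, K N y ∂stepLaw p ≠ ⊤ := fun N => by
    rw [hKA]
    exact ne_top_of_le_ne_top hfin (ENNReal.sum_le_tsum _)
  have hFfin : ∀ᵐ y ∂stepLaw p, F y < ⊤ := ae_lt_top hFm (hFA ▸ hfin)
  have hKfin : ∀ N y, K N y < ⊤ := fun N y => ENNReal.sum_lt_top.2 fun l _ => ENNReal.coe_lt_top
  have hFi : ∫ y, (F y).toReal ∂stepLaw p = A.toReal := by
    rw [integral_toReal hFm.aemeasurable hFfin, hFA]
  have hFfin' : ∀ᵐ y ∂stepLaw p, ∀ i, F (shift^[i] y) < ⊤ :=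
    ae_all_iff.2 fun i => ((measurePreserving_shift p).iterate i).quasiMeasurePreserving.ae hFfin
  have hFB := ae_tendsto_birkhoffSum_div (ergodic_shift p) hFm.ennreal_toReal
    (integrable_toReal_of_lintegral_ne_top hFm.aemeasurable (hFA ▸ hfin))
  have hKB := ae_all_iff.2 fun N => ae_tendsto_birkhoffSum_div (ergodic_shift p)
    (hKm N).ennreal_toReal
    (integrable_toReal_of_lintegral_ne_top (hKm N).aemeasurable (hKtop N))
  have hlim : Tendsto (fun N => ∫ y, (K N y).toReal ∂stepLaw p) atTop (𝓝 A.toReal) := by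
    have : ∀ N, ∫ y, (K N y).toReal ∂stepLaw p
        = (∑ l ∈ Finset.range N, ∫⁻ y, (c (pos (l + 1) y) : ℝ≥0∞) ∂stepLaw p).toReal := fun N => by
      rw [integral_toReal (hKm N).aemeasurable (Eventually.of_forall (hKfin N)), hKA]
    simp_rw [this]
    exact (ENNReal.tendsto_toReal hfin).comp (ENNReal.tendsto_nat_tsum _)
  filter_upwards [hFfin', hFB, hKB] with y hy hyF hyK
  have hKr : ∀ N z, (K N z).toReal = ∑ l ∈ Finset.range N, (c (pos (l + 1) z) : ℝ) := fun N z => by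
    rw [hK, ENNReal.toReal_sum fun l _ => ENNReal.coe_ne_top]
    rfl
  have hup : ∀ n, pairSum (fun x => c x) n y ≤ birkhoffSum shift (fun z => (F z).toReal) n y := by
    intro n
    rw [pairSum_eq_sum_shift, birkhoffSum]
    refine Finset.sum_le_sum fun i _ => ?_
    rw [← hKr]
    exact ENNReal.toReal_mono (hy i).ne (ENNReal.sum_le_tsum _)
  -- With `n + N` positions, each `i < n` has at least `N` later ones, so all of `K N` fits
  -- untruncated.
  have hlow : ∀ N n, birkhoffSum shift (fun z => (K N z).toReal) n y
      ≤ pairSum (fun x => c x) (n + N) y := by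
    intro N n
    rw [pairSum_eq_sum_shift, birkhoffSum]
    refine (Finset.sum_le_sum (g := fun i => ∑ l ∈ Finset.range (n + N - (i + 1)),
      (c (pos (l + 1) (shift^[i] y)) : ℝ)) fun i hi => ?_).trans
      (Finset.sum_le_sum_of_subset_of_nonneg
        (Finset.range_subset_range.2 (Nat.le_add_right n N)) fun i _ _ =>
          Finset.sum_nonneg fun l _ => NNReal.coe_nonneg _)
    rw [hKr]
    refine Finset.sum_le_sum_of_subset_of_nonneg
      (Finset.range_subset_range.2 ?_) fun l _ _ => NNReal.coe_nonneg _
    have := Finset.mem_range.1 hi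
    omega
  rw [hFi] at hyF
  refine tendsto_order.2 ⟨fun a ha => ?_, fun a ha => ?_⟩
  · obtain ⟨N, hN⟩ := ((tendsto_order.1 hlim).1 a ha).exists
    have hratio : Tendsto (fun n : ℕ => (n : ℝ) / ((n + N : ℕ) : ℝ)) atTop (𝓝 1) := by
      simpa using tendsto_natCast_div_add_atTop (N : ℝ)
    have h1 : Tendsto (fun n : ℕ => birkhoffSum shift (fun z => (K N z).toReal) n y
        / ((n + N : ℕ) : ℝ)) atTop (𝓝 (∫ z, (K N z).toReal ∂stepLaw p)) := by
      have h2 := (hyK N).mul hratio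
      rw [mul_one] at h2
      refine h2.congr' ?_
      filter_upwards [eventually_gt_atTop 0] with n hn
      have : (n : ℝ) ≠ 0 := by exact_mod_cast hn.ne'
      rw [div_mul_div_cancel₀ this]
    have h3 := (tendsto_order.1 h1).1 a hN
    rw [← map_add_atTop_eq_nat N, eventually_map]
    filter_upwards [h3] with n hn
    exact hn.trans_le (div_le_div_of_nonneg_right (hlow N n) (Nat.cast_nonneg _))
  · filter_upwards [(tendsto_order.1 hyF).2 a ha] with n hn
    exact (div_le_div_of_nonneg_right (hup n) (Nat.cast_nonneg _)).trans_lt hn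

end PairSums

/-! ### Correlations and expansion of the variance -/

section Correlation

variable {E : Type*} [MeasurableSpace E] {μ : Measure E} {T : E ≃ᵐ E} {f : E → ℝ}

lemma iter_add (T : E ≃ᵐ E) (a b : ℤ) (e : E) : iter T (a + b) e = iter T a (iter T b e) := by
  simp [iter, zpow_add]

lemma iter_zero (T : E ≃ᵐ E) (e : E) : iter T 0 e = e := by simp [iter]

lemma measurePreserving_iter (hT : MeasurePreserving T μ μ) (a : ℤ) :
    MeasurePreserving (iter T a) μ μ := by
  induction a using Int.induction_on with
  | zero =>
    rw [show iter T 0 = id from funext (iter_zero T)]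
    exact MeasurePreserving.id μ
  | succ n ih =>
    have : iter T (n + 1) = T ∘ iter T n := by
      ext e
      rw [add_comm, iter_add]
      simp [iter]
    rw [this]
    exact hT.comp ih
  | pred n ih =>
    have : iter T (-n - 1) = T.symm ∘ iter T (-n) := by
      ext e
      rw [sub_eq_add_neg, add_comm, iter_add]
      simp only [iter, zpow_neg_one, Function.comp_apply]
      rfl
    rw [this]
    exact (hT.symm T).comp ih

lemma memLp_comp_iter (hT : MeasurePreserving T μ μ) (hf : MemLp f 2 μ) (a : ℤ) :
    MemLp (fun e => f (iter T a e)) 2 μ :=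
  hf.comp_measurePreserving (measurePreserving_iter hT a)

lemma integral_iter_mul_iter (hT : MeasurePreserving T μ μ) (hf : MemLp f 2 μ) (a b : ℤ) :
    ∫ e, f (iter T a e) * f (iter T b e) ∂μ = corr μ T f (b - a) := by
  have h := measurePreserving_iter hT a
  have hm : AEStronglyMeasurable (fun e => f e * f (iter T (b - a) e)) (μ.map (iter T a)) := by
    rw [h.map_eq]
    exact hf.aestronglyMeasurable.mul (memLp_comp_iter hT hf _).aestronglyMeasurable
  have h2 := integral_map h.measurable.aemeasurable hm
  rw [h.map_eq] at h2
  rw [corr, h2]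
  simp_rw [← iter_add, sub_add_cancel]

lemma corr_neg (hT : MeasurePreserving T μ μ) (hf : MemLp f 2 μ) (x : ℤ) :
    corr μ T f (-x) = corr μ T f x := by
  have h := integral_iter_mul_iter hT hf (-x) 0
  rw [zero_sub, neg_neg] at h
  rw [← h, corr]
  simp_rw [iter_zero, mul_comm]

lemma corr_zero (μ : Measure E) (T : E ≃ᵐ E) (f : E → ℝ) : corr μ T f 0 = ∫ e, f e ^ 2 ∂μ := by
  simp_rw [corr, iter_zero, sq]

variable {Ω : Type*}

lemma quenchedVar_eq_sum_corr (hT : MeasurePreserving T μ μ) (hf : MemLp f 2 μ)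
    (X : ℕ → Ω → ℤ) (n : ℕ) (ω : Ω) :
    quenchedVar X μ T f n ω = ∑ i ∈ Finset.range (n + 1), ∑ j ∈ Finset.range (n + 1),
      corr μ T f (walk X i ω - walk X j ω) := by
  have hint : ∀ a b : ℤ, Integrable (fun e => f (iter T a e) * f (iter T b e)) μ := fun a b =>
    (memLp_comp_iter hT hf a).integrable_mul (memLp_comp_iter hT hf b)
  rw [quenchedVar]
  simp_rw [sq_abs, sq, Finset.sum_mul_sum]
  rw [integral_finsetSum _ fun i _ => integrable_finsetSum _ fun j _ => hint _ _]
  refine Finset.sum_congr rfl fun i _ => ?_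
  rw [integral_finsetSum _ fun j _ => hint _ _]
  refine Finset.sum_congr rfl fun j _ => ?_
  rw [← integral_iter_mul_iter hT hf]
  simp_rw [mul_comm]

lemma hasSum_selfIntersection_mul (X : ℕ → Ω → ℤ) (n : ℕ) (ω : Ω) (g : ℤ → ℝ) :
    HasSum (fun z => selfIntersection X n z ω * g z)
      (∑ i ∈ Finset.range (n + 1), ∑ j ∈ Finset.range (n + 1),
        g (walk X i ω - walk X j ω)) := by
  simp_rw [selfIntersection, Finset.sum_mul]
  refine hasSum_sum fun i _ => hasSum_sum fun j _ => ?_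
  have h := hasSum_single (f := fun z : ℤ =>
    (if walk X i ω - walk X j ω = z then (1 : ℝ) else 0) * g z) (walk X i ω - walk X j ω)
    fun z hz => by rw [if_neg hz.symm, zero_mul]
  simpa using h

end Correlation

/-! ### Transfer to the given walk -/

section Green

variable {Ω : Type*} [MeasurableSpace Ω] {P : Measure Ω} {X : ℕ → Ω → ℤ}

lemma map_steps_eq_stepLaw (hm : ∀ i, Measurable (X i)) (hi : iIndepFun X P)
    (hd : ∀ i, IdentDistrib (X i) (X 0) P P) :
    P.map (fun ω i => X i ω) = stepLaw (P.map (X 0)) := by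
  rw [hi.map_fun_eq_infinitePi_map hm]
  simp_rw [fun i => (hd i).map_eq]

lemma measurable_steps (hm : ∀ i, Measurable (X i)) : Measurable fun ω i => X i ω :=
  measurable_pi_lambda _ hm

lemma green_nonneg (x : ℤ) : 0 ≤ green P X x := tsum_nonneg fun _ => measureReal_nonneg

lemma stepLaw_pos_eq (hm : ∀ i, Measurable (X i)) (hi : iIndepFun X P)
    (hd : ∀ i, IdentDistrib (X i) (X 0) P P) (k : ℕ) (x : ℤ) :
    stepLaw (P.map (X 0)) {y | pos k y = x} = P {ω | walk X k ω = x} := by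
  rw [← map_steps_eq_stepLaw hm hi hd,
    Measure.map_apply (measurable_steps hm) (measurableSet_pos_eq k x)]
  rfl

variable [IsProbabilityMeasure P]

/-- The real series `green` would default to `0` if it diverged; transience excludes this. -/
lemma tsum_stepLaw_pos_eq_ofReal_green (hm : ∀ i, Measurable (X i)) (hi : iIndepFun X P)
    (hd : ∀ i, IdentDistrib (X i) (X 0) P P) (htr : IsTransient P X) (x : ℤ) :
    ∑' k, stepLaw (P.map (X 0)) {y | pos k y = x} = ENNReal.ofReal (green P X x) := by
  have := Measure.isProbabilityMeasure_map (μ := P) (hm 0).aemeasurable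
  have hR : stepLaw (P.map (X 0)) {y | ∃ n : ℕ, 1 ≤ n ∧ pos n y = 0} < 1 := by
    rw [← map_steps_eq_stepLaw hm hi hd,
      Measure.map_apply (measurable_steps hm) measurableSet_return]
    exact htr
  have htop := tsum_pos_ne_top (P.map (X 0)) hR x
  rw [← ENNReal.ofReal_toReal htop, ENNReal.tsum_toReal_eq fun k => measure_ne_top _ _, green]
  simp_rw [stepLaw_pos_eq hm hi hd]
  rfl

/-- The almost sure limit of the averaged pair sums of a nonnegative function. -/
lemma ae_tendsto_pairSum_steps_nnreal (hm : ∀ i, Measurable (X i)) (hi : iIndepFun X P)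
    (hd : ∀ i, IdentDistrib (X i) (X 0) P P) (htr : IsTransient P X) (c : ℤ → ℝ≥0)
    (hc : Summable fun x => green P X x * c x) :
    ∀ᵐ ω ∂P, Tendsto (fun n : ℕ => pairSum (fun x => c x) n (fun i => X i ω) / n) atTop
      (𝓝 ((∑' x, green P X x * c x) - c 0)) := by
  have := Measure.isProbabilityMeasure_map (μ := P) (hm 0).aemeasurable
  set p := P.map (X 0)
  have hnn : ∀ x, 0 ≤ green P X x * c x := fun x => mul_nonneg (green_nonneg x) (c x).2
  have htot : ∑' k, ∫⁻ y, (c (pos k y) : ℝ≥0∞) ∂stepLaw p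
      = ENNReal.ofReal (∑' x, green P X x * c x) := by
    rw [tsum_lintegral_comp_pos, ENNReal.ofReal_tsum_of_nonneg hnn hc]
    refine tsum_congr fun x => ?_
    rw [tsum_stepLaw_pos_eq_ofReal_green hm hi hd htr, ENNReal.ofReal_mul (green_nonneg x),
      ENNReal.ofReal_coe_nnreal, mul_comm]
  -- The Green function counts time `0`, which pairs `i < j` omit: hence the `- c 0` in the limit.
  have hsplit : ∑' k, ∫⁻ y, (c (pos k y) : ℝ≥0∞) ∂stepLaw p
      = c 0 + ∑' l, ∫⁻ y, (c (pos (l + 1) y) : ℝ≥0∞) ∂stepLaw p := by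
    rw [tsum_eq_zero_add' ENNReal.summable]
    simp [pos]
  have hfin : ∑' l, ∫⁻ y, (c (pos (l + 1) y) : ℝ≥0∞) ∂stepLaw p ≠ ⊤ := by
    refine ne_top_of_le_ne_top ?_ (le_add_self (b := (c 0 : ℝ≥0∞)))
    rw [← hsplit, htot]
    exact ENNReal.ofReal_ne_top
  have hval : (∑' l, ∫⁻ y, (c (pos (l + 1) y) : ℝ≥0∞) ∂stepLaw p).toReal
      = (∑' x, green P X x * c x) - c 0 := by
    have h := congrArg ENNReal.toReal (hsplit.symm.trans htot)
    rw [ENNReal.toReal_add ENNReal.coe_ne_top hfin, ENNReal.toReal_ofReal (tsum_nonneg hnn),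
      ENNReal.coe_toReal] at h
    linarith
  have h := ae_tendsto_pairSum_nnreal p c hfin
  rw [hval, ← map_steps_eq_stepLaw hm hi hd] at h
  exact ae_of_ae_map (measurable_steps hm).aemeasurable h

/-- Real summability is absolute, so the positive and negative parts of `g` are each summable
against `green`. -/
lemma ae_tendsto_pairSum_steps (hm : ∀ i, Measurable (X i)) (hi : iIndepFun X P)
    (hd : ∀ i, IdentDistrib (X i) (X 0) P P) (htr : IsTransient P X) (g : ℤ → ℝ)
    (hg : Summable fun x => green P X x * g x) :
    ∀ᵐ ω ∂P, Tendsto (fun n : ℕ => pairSum g n (fun i => X i ω) / n) atTop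
      (𝓝 ((∑' x, green P X x * g x) - g 0)) := by
  have hdec : ∀ x, g x = ((g x).toNNReal : ℝ) - ((-g x).toNNReal : ℝ) := fun x => by
    rw [Real.coe_toNNReal', Real.coe_toNNReal', max_comm, max_comm (-g x)]
    rcases le_total 0 (g x) with h | h <;> simp [h]
  have hbound : ∀ c : ℤ → ℝ≥0, (∀ x, (c x : ℝ) ≤ |g x|) →
      Summable fun x => green P X x * c x := fun c hc =>
    Summable.of_nonneg_of_le (fun x => mul_nonneg (green_nonneg x) (c x).2) (fun x => by
      rw [abs_mul, abs_of_nonneg (green_nonneg x)]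
      exact mul_le_mul_of_nonneg_left (hc x) (green_nonneg x)) hg.abs
  have hp := hbound (fun x => (g x).toNNReal) fun x => by
    rw [Real.coe_toNNReal']; exact max_le (le_abs_self _) (abs_nonneg _)
  have hn := hbound (fun x => (-g x).toNNReal) fun x => by
    rw [Real.coe_toNNReal']; exact max_le (neg_le_abs _) (abs_nonneg _)
  filter_upwards [ae_tendsto_pairSum_steps_nnreal hm hi hd htr _ hp,
    ae_tendsto_pairSum_steps_nnreal hm hi hd htr _ hn] with ω h1 h2
  have hlim : (∑' x, green P X x * g x) - g 0
      = ((∑' x, green P X x * (g x).toNNReal) - (g 0).toNNReal)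
        - ((∑' x, green P X x * (-g x).toNNReal) - (-g 0).toNNReal) := by
    have : ∑' x, green P X x * g x = (∑' x, green P X x * (g x).toNNReal)
        - ∑' x, green P X x * (-g x).toNNReal := by
      rw [← hp.tsum_sub hn]
      exact tsum_congr fun x => by rw [← mul_sub, ← hdec]
    rw [this]
    linarith [hdec 0]
  rw [hlim]
  refine (h1.sub h2).congr fun n => ?_
  rw [← sub_div, pairSum, pairSum, pairSum, ← Finset.sum_sub_distrib]
  simp_rw [← Finset.sum_sub_distrib, ← hdec]

end Green

end SampledWalk

open SampledWalk in
theorem proposition4p1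
    {Ω E : Type*} [MeasurableSpace Ω] [MeasurableSpace E]
    (P : Measure Ω) [IsProbabilityMeasure P]
    (X : ℕ → Ω → ℤ) (hX_meas : ∀ i, Measurable (X i))
    (hX_indep : iIndepFun X P) (hX_ident : ∀ i, IdentDistrib (X i) (X 0) P P)
    (hX_trans : IsTransient P X)
    (μ : Measure E) [IsProbabilityMeasure μ]
    (T : E ≃ᵐ E) (hT : MeasurePreserving T μ μ)
    (f : E → ℝ) (hf : MemLp f 2 μ) (hf_mean : ∫ e, f e ∂μ = 0)
    (hsum : Summable fun x : ℤ => green P X x * corr μ T f x) :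
    (∀ (n : ℕ) (ω : Ω),
      HasSum (fun z : ℤ => selfIntersection X n z ω * corr μ T f z)
        (quenchedVar X μ T f n ω)) ∧
    ∀ᵐ ω ∂P, Tendsto (fun n : ℕ => quenchedVar X μ T f n ω / n) atTop
      (𝓝 (limitVar P X μ T f)) := by
  refine ⟨fun n ω => ?_, ?_⟩
  · rw [quenchedVar_eq_sum_corr hT hf]
    exact hasSum_selfIntersection_mul X n ω _
  filter_upwards [ae_tendsto_pairSum_steps hX_meas hX_indep hX_ident hX_trans _ hsum] with ω hω
  have hratio : Tendsto (fun n : ℕ => ((n + 1 : ℕ) : ℝ) / n) atTop (𝓝 1) := by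
    have h := (tendsto_natCast_div_add_atTop (1 : ℝ)).inv₀ one_ne_zero
    simpa using h
  have hlim := (((tendsto_add_atTop_iff_nat 1).2 hω).const_mul 2).const_add (corr μ T f 0)
    |>.mul hratio
  have hval : (corr μ T f 0 + 2 * ((∑' x, green P X x * corr μ T f x) - corr μ T f 0)) * 1
      = limitVar P X μ T f := by
    rw [limitVar, ← corr_zero μ T f]
    ring
  rw [hval] at hlim
  -- The identity holds for `n = 0` too, both sides being quotients by zero.
  refine hlim.congr fun n => ?_
  have hq : quenchedVar X μ T f n ω = ((n + 1 : ℕ) : ℝ) * corr μ T f 0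
      + 2 * pairSum (corr μ T f) (n + 1) (fun i => X i ω) := by
    rw [quenchedVar_eq_sum_corr hT hf, ← sum_sum_eq_pairSum (corr_neg hT hf)]
    rfl
  have hn : ((n + 1 : ℕ) : ℝ) ≠ 0 := Nat.cast_ne_zero.2 n.succ_ne_zero
  rw [hq]
  field_simp
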